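/- Let $d\ge 2$ and let $S^{d-1}$ be the unit sphere in $\mathbb R^d$. For a function $\varphi\colon S^{d-1}\to\mathbb R$ and $\lambda\in\mathbb R$ let $A_\lambda$ be the Fourier multiplier on $\mathbb R^d$ with symbol $\xi\mapsto e^{i\lambda\varphi(\xi/|\xi|)}$, that is, $\widehat{A_\lambda f}(\xi)=e^{i\lambda\varphi(\xi/|\xi|)}\hat f(\xi)$ for Schwartz functions $f$, and let $\|A_\lambda\|_{L_p\to L_p}\in[0,\infty]$ be the least constant $c$ such that $\|A_\lambda f\|_{L_p(\mathbb R^d)}\le c\,\|f\|_{L_p(\mathbb R^d)}$ for all Schwartz functions $f$. There exist a real-valued $C^\infty$ function $\varphi$ on $S^{d-1}$ and constants $C>0$ and $\Lambda>0$ such that $$\|A_\lambda\|_{L_p\to L_p}\ \ge\ C\,|\lambda|^{\,d\left|\frac12-\frac1p\right|}$$ for all $1<p<\infty$ and all real $\lambda$ with $|\lambda|\ge\Lambda$. -/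

import Mathlib

open MeasureTheory Metric FourierTransform
open scoped ENNReal Manifold ContDiff SchwartzMap

noncomputable section

/-- `φ : S^{d-1} → ℝ` is a `C^∞` function on the unit sphere of `ℝ^d`, the sphere being the smooth
manifold of dimension `d - 1` provided by Mathlib. -/
def SmoothOnSphere {d : ℕ} (hd : 2 ≤ d)
    (φ : sphere (0 : EuclideanSpace ℝ (Fin d)) 1 → ℝ) : Prop :=
  haveI : Fact (Module.finrank ℝ (EuclideanSpace ℝ (Fin d)) = (d - 1) + 1) :=
    ⟨by rw [finrank_euclideanSpace_fin]; omega⟩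
  ContMDiff (𝓡 (d - 1)) 𝓘(ℝ, ℝ) ∞ φ

/-- The direction `ξ / |ξ|` of a nonzero vector, as a point of the unit sphere. -/
def direction {d : ℕ} (ξ : EuclideanSpace ℝ (Fin d)) (hξ : ξ ≠ 0) :
    sphere (0 : EuclideanSpace ℝ (Fin d)) 1 :=
  ⟨‖ξ‖⁻¹ • ξ, by simp [norm_smul, hξ]⟩

open Classical in
/-- The symbol `ξ ↦ exp (i λ φ(ξ / |ξ|))`, homogeneous of degree zero. Its value at the single
point `ξ = 0` is immaterial and set to be `1`. -/
def oscSymbol {d : ℕ} (φ : sphere (0 : EuclideanSpace ℝ (Fin d)) 1 → ℝ) (lam : ℝ)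
    (ξ : EuclideanSpace ℝ (Fin d)) : ℂ :=
  if hξ : ξ = 0 then 1
  else Complex.exp (Complex.I * ((lam * φ (direction ξ hξ) : ℝ) : ℂ))

/-- The Fourier multiplier with symbol `m` on Schwartz functions:
`(A f)(x) = ∫ m(ξ) (𝓕 f)(ξ) e^{2πi⟨x, ξ⟩} dξ`. -/
def multiplierOp {d : ℕ} (m : EuclideanSpace ℝ (Fin d) → ℂ)
    (f : 𝓢(EuclideanSpace ℝ (Fin d), ℂ)) : EuclideanSpace ℝ (Fin d) → ℂ :=
  𝓕⁻ (fun ξ : EuclideanSpace ℝ (Fin d) => m ξ * 𝓕 (f : EuclideanSpace ℝ (Fin d) → ℂ) ξ)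

/-- The `L_p(ℝ^d) → L_p(ℝ^d)` norm of the Fourier multiplier with symbol `m`: the least
`c ∈ [0, ∞]` with `‖A f‖_p ≤ c ‖f‖_p` for all `f` in the Schwartz class, which is dense in
`L_p(ℝ^d)` for `1 ≤ p < ∞`. It is `∞` if the multiplier is not bounded on `L_p`. -/
def multiplierNorm {d : ℕ} (m : EuclideanSpace ℝ (Fin d) → ℂ) (p : ℝ≥0∞) : ℝ≥0∞ :=
  sInf {c : ℝ≥0∞ | ∀ f : 𝓢(EuclideanSpace ℝ (Fin d), ℂ),
    eLpNorm (multiplierOp m f) p volume ≤ c * eLpNorm (f : EuclideanSpace ℝ (Fin d) → ℂ) p volume}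

end

/-! Let `a` be a bump supported in 1 < ξ₀ < 2, |ξⱼ| < ξ₀, and let f_λ be the packet with Fourier
transform a·exp(iλφ). Then A_λ f_μ = f_{λ+μ}, Plancherel makes ‖f_λ‖₂ independent of λ, and
`exists_norm_packet_le` gives ‖f_λ‖_∞ ≲ |λ|^(-d/2). Comparing L_p with L₂ and L_∞, ‖f_λ‖_p ≳
|λ|^(d(1/p-1/2)) for p ≤ 2 and ‖f_λ‖_p ≲ |λ|^(-d(1/2-1/p)) for p ≥ 2. Testing A_λ on f_0 when p ≤ 2,
and on f_{-λ} (which it maps to f_0) when p ≥ 2, gives the bound.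

The sup bound dictates φ, since a phase homogeneous of degree zero does not oscillate radially. In
the coordinates r = ξ₀, uⱼ = ξⱼ/ξ₀ it is linear in u₁ and quadratic in the other d - 2 variables.
Each quadratic variable contributes |λ|^(-1/2). The linear one forces λ + r x₁ = 0 at a stationary
point, so that r u₁ x₁ is nondegenerate in (r, u₁) with size |λ|, and this pair contributes
|λ|^(-1). -/

/-! ### One-dimensional oscillatory integrals. -/

-- Damping by exp(-πεu²) turns the chirp into a Gaussian of complex width b = ε - iλ. Its Fourier
-- transform is at most |b|^(-1/2) ≤ |λ|^(-1/2) because Re(1/b) ≥ 0. Move the transform across the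
-- pairing with χ and let ε → 0.
open Filter Topology in
theorem norm_integral_mul_cexp_sq_le (χ : 𝓢(ℝ, ℂ)) {lam : ℝ} (hlam : lam ≠ 0) (y : ℝ) :
    ‖∫ u : ℝ, χ u * Complex.exp ((Real.pi * (lam * u ^ 2) + 2 * Real.pi * (y * u) : ℝ) * Complex.I)‖
      ≤ (∫ w : ℝ, ‖(𝓕⁻ χ) w‖) * |lam| ^ (-(1 / 2) : ℝ) := by
  set G : ℝ → ℝ → ℂ := fun ε u => Complex.exp
    (-Real.pi * ((ε : ℂ) - lam * Complex.I) * u ^ 2 + 2 * Real.pi * (y * Complex.I) * u) with hG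
  have hnorm : ∀ ε u : ℝ, 0 ≤ ε → ‖G ε u‖ ≤ 1 := by
    intro ε u hε
    rw [hG, Complex.norm_exp]
    simp only [Real.exp_le_one_iff]
    have : (-Real.pi * ((ε : ℂ) - lam * Complex.I) * u ^ 2 +
        2 * Real.pi * (y * Complex.I) * u).re = -(Real.pi * ε * u ^ 2) := by
      simp [pow_two]
    rw [this]
    have := Real.pi_pos
    simp only [Left.neg_nonpos_iff]
    positivity
  have hcont : ∀ ε : ℝ, Continuous (G ε) := by intro ε; rw [hG]; fun_prop
  have hre : ∀ ε : ℝ, ((ε : ℂ) - lam * Complex.I).re = ε := by intro ε; simp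
  have hbound : ∀ ε : ℝ, 0 < ε →
      ‖∫ u, χ u * G ε u‖ ≤ (∫ w : ℝ, ‖(𝓕⁻ χ) w‖) * |lam| ^ (-(1 / 2) : ℝ) := by
    intro ε hε
    set b : ℂ := (ε : ℂ) - lam * Complex.I with hb
    have hb0 : 0 < b.re := by rw [hb, hre]; exact hε
    have hGint : Integrable (G ε) := by
      have := integrable_cexp_quadratic (b := Real.pi * b) (by simpa using mul_pos Real.pi_pos hb0)
        (2 * Real.pi * (y * Complex.I)) 0
      refine this.congr (Eventually.of_forall fun u => ?_)
      simp only [hG, add_zero]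
      congr 1
      ring
    have hF := fourier_gaussian_pi' hb0 (y * Complex.I)
    have key : ∫ u, χ u * G ε u = ∫ w, (𝓕⁻ χ) w * 𝓕 (G ε) w := by
      have h := VectorFourier.integral_fourierIntegral_smul_eq_flip (μ := volume) (ν := volume)
        (L := innerₗ ℝ) (f := (𝓕⁻ χ : 𝓢(ℝ, ℂ))) (g := G ε)
        Real.continuous_fourierChar continuous_inner (SchwartzMap.integrable _) hGint
      rw [flip_innerₗ] at h
      have h2 : ∀ u, VectorFourier.fourierIntegral Real.fourierChar volume (innerₗ ℝ)
          (𝓕⁻ χ : 𝓢(ℝ, ℂ)) u = χ u := by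
        intro u
        have : (𝓕 (𝓕⁻ χ : 𝓢(ℝ, ℂ)) : 𝓢(ℝ, ℂ)) u = χ u := by
          rw [FourierTransform.fourier_fourierInv_eq]
        rw [← this]; rfl
      simp only [h2, smul_eq_mul] at h
      exact h
    have hbn : |lam| ≤ ‖b‖ := by
      have := Complex.abs_im_le_norm b
      simpa [hb] using this
    have hlam' : 0 < |lam| := abs_pos.2 hlam
    have hFb : ∀ w, ‖𝓕 (G ε) w‖ ≤ |lam| ^ (-(1 / 2) : ℝ) := by
      intro w
      have e1 : 𝓕 (G ε) w = 1 / b ^ (1 / 2 : ℂ) *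
          Complex.exp (-Real.pi / b * (w + Complex.I * (y * Complex.I)) ^ 2) := congrFun hF w
      rw [e1, norm_mul]
      have e2 : ‖Complex.exp (-Real.pi / b * (w + Complex.I * (y * Complex.I)) ^ 2)‖ ≤ 1 := by
        rw [Complex.norm_exp, Real.exp_le_one_iff]
        have : (w : ℂ) + Complex.I * (y * Complex.I) = ((w - y : ℝ) : ℂ) := by
          have := Complex.I_mul_I
          push_cast
          linear_combination (y : ℂ) * this
        rw [this]
        have : (-Real.pi / b * ((w - y : ℝ) : ℂ) ^ 2) = ((Real.pi * (w - y) ^ 2 : ℝ) : ℂ) * (-b⁻¹) := by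
          push_cast; ring
        rw [this, Complex.re_ofReal_mul, Complex.neg_re, Complex.inv_re]
        have h1 : 0 ≤ b.re / Complex.normSq b := div_nonneg hb0.le (Complex.normSq_nonneg _)
        have h2 : 0 ≤ Real.pi * (w - y) ^ 2 := by have := Real.pi_pos; positivity
        nlinarith [mul_nonneg h2 h1]
      have e3 : ‖1 / b ^ (1 / 2 : ℂ)‖ ≤ |lam| ^ (-(1 / 2) : ℝ) := by
        have hb1 : b ≠ 0 := by intro h; simp [h] at hb0
        have : ‖b ^ (1 / 2 : ℂ)‖ = ‖b‖ ^ (1 / 2 : ℝ) := by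
          have := Complex.norm_cpow_real b (1 / 2 : ℝ)
          rw [← this]; norm_num
        rw [norm_div, norm_one, this, Real.rpow_neg hlam'.le, one_div]
        gcongr
      calc _ ≤ |lam| ^ (-(1 / 2) : ℝ) * 1 := by gcongr
        _ = _ := mul_one _
    rw [key, ← integral_mul_const]
    refine norm_integral_le_of_norm_le ((SchwartzMap.integrable _).norm.mul_const _)
      (Eventually.of_forall fun w => ?_)
    rw [norm_mul]
    gcongr
    exact hFb w
  have hlim : Tendsto (fun ε : ℝ => ∫ u, χ u * G ε u) (𝓝[>] 0) (𝓝 (∫ u, χ u * G 0 u)) := by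
    refine tendsto_integral_filter_of_dominated_convergence (fun u => ‖χ u‖) ?_ ?_
      χ.integrable.norm ?_
    · exact Eventually.of_forall fun ε => (χ.continuous.mul (hcont ε)).aestronglyMeasurable
    · filter_upwards [self_mem_nhdsWithin] with ε hε
      refine Eventually.of_forall fun u => ?_
      rw [norm_mul]
      exact mul_le_of_le_one_right (norm_nonneg _) (hnorm ε u (le_of_lt hε))
    · refine Eventually.of_forall fun u => ?_
      have : Continuous fun ε : ℝ => χ u * G ε u := by simp only [hG]; fun_prop
      exact (this.tendsto 0).mono_left nhdsWithin_le_nhds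
  have := le_of_tendsto hlim.norm (by filter_upwards [self_mem_nhdsWithin] with ε hε using hbound ε hε)
  refine le_trans (le_of_eq ?_) this
  congr 2
  ext u
  simp only [hG]
  congr 2
  push_cast
  ring

/-- This is the gain |λ|⁻¹ of the pair (r, u₁), uniform in the space variable y. -/
theorem exists_setIntegral_norm_comp_affine_le (η : 𝓢(ℝ, ℂ)) :
    ∃ C : ℝ, 0 ≤ C ∧ ∀ lam : ℝ, lam ≠ 0 → ∀ y : ℝ,
      ∫ r in Set.Icc (1 : ℝ) 2, ‖η (-(lam + r * y))‖ ≤ C * |lam|⁻¹ := by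
  obtain ⟨D, hD0, hD⟩ := η.decay 1 0
  have hD : ∀ w : ℝ, |w| * ‖η w‖ ≤ D := by simpa using hD
  refine ⟨max (2 * D) (4 * ∫ w, ‖η w‖), le_max_of_le_left (by positivity), fun lam hlam y => ?_⟩
  have hlam' : 0 < |lam| := abs_pos.2 hlam
  -- If 4|y| ≤ |λ|, then |λ + ry| ≥ |λ|/2 since r ≤ 2, and first-order decay suffices. Otherwise
  -- substituting w = ry costs |y|⁻¹ < 4|λ|⁻¹.
  rcases le_or_gt (4 * |y|) |lam| with hy | hy
  · have h : ∀ r ∈ Set.Icc (1 : ℝ) 2, ‖η (-(lam + r * y))‖ ≤ 2 * D * |lam|⁻¹ := by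
      intro r hr
      have h1 : |lam| / 2 ≤ |-(lam + r * y)| := by
        rw [abs_neg]
        have h2 : |lam| ≤ |lam + r * y| + |r * y| := by
          have := abs_sub (lam + r * y) (r * y)
          simpa using this
        have h3 : |r * y| ≤ 2 * |y| := by
          rw [abs_mul, abs_of_nonneg (by linarith [hr.1])]
          gcongr
          exact hr.2
        linarith
      have h4 := hD (-(lam + r * y))
      have h5 : |lam| / 2 * ‖η (-(lam + r * y))‖ ≤ D :=
        (mul_le_mul_of_nonneg_right h1 (norm_nonneg _)).trans h4
      rw [← div_eq_mul_inv, le_div_iff₀ hlam']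
      linarith
    have := setIntegral_mono_on (μ := volume) (s := Set.Icc (1 : ℝ) 2)
      (f := fun r => ‖η (-(lam + r * y))‖) (g := fun _ => 2 * D * |lam|⁻¹)
      ((by have := η.continuous; fun_prop : Continuous fun r => ‖η (-(lam + r * y))‖).integrableOn_Icc)
      continuous_const.integrableOn_Icc measurableSet_Icc h
    refine this.trans ?_
    have hv : (volume.restrict (Set.Icc (1 : ℝ) 2)).real Set.univ = 1 := by
      simp only [MeasurableSet.univ, measureReal_restrict_apply, Set.univ_inter, Real.volume_real_Icc]
      norm_num
    rw [integral_const, hv, one_smul]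
    gcongr
    exact le_max_left _ _
  · have hy0 : 0 < |y| := by linarith [abs_nonneg y]
    have hint : Integrable fun r : ℝ => ‖η (-(lam + r * y))‖ := by
      have h1 : Integrable fun w : ℝ => η (-(lam + w)) := by
        have h := (η.integrable (μ := volume)).comp_neg.comp_add_left lam
        exact h
      exact (h1.comp_mul_right' (abs_pos.1 hy0)).norm
    have h1 : ∫ r in Set.Icc (1 : ℝ) 2, ‖η (-(lam + r * y))‖ ≤ ∫ r, ‖η (-(lam + r * y))‖ :=
      setIntegral_le_integral hint (Filter.Eventually.of_forall fun _ => norm_nonneg _)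
    have h2 : ∫ r, ‖η (-(lam + r * y))‖ = |y|⁻¹ * ∫ w, ‖η w‖ := by
      rw [Measure.integral_comp_mul_right (fun w => ‖η (-(lam + w))‖) y,
        integral_add_left_eq_self (fun w => ‖η (-w)‖), integral_neg_eq_self (fun w => ‖η w‖),
        smul_eq_mul, abs_inv]
    rw [h2] at h1
    refine h1.trans ?_
    have h3 : |y|⁻¹ ≤ 4 * |lam|⁻¹ := by
      rw [← div_eq_mul_inv, le_div_iff₀ hlam', inv_mul_le_iff₀ hy0]
      linarith
    have h4 : 0 ≤ ∫ w, ‖η w‖ := integral_nonneg fun _ => norm_nonneg _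
    calc _ ≤ 4 * |lam|⁻¹ * ∫ w, ‖η w‖ := by gcongr
      _ = (4 * ∫ w, ‖η w‖) * |lam|⁻¹ := by ring
      _ ≤ _ := by gcongr; exact le_max_right _ _

theorem norm_integral_dilate_mul_cexp_sq_le (χ : 𝓢(ℝ, ℂ)) {lam : ℝ} (hlam : lam ≠ 0) (y : ℝ)
    {r : ℝ} (hr : 0 < r) :
    ‖∫ v : ℝ, χ (v / r) *
        Complex.exp ((lam * (Real.pi * (v / r) ^ 2) + 2 * Real.pi * (v * y) : ℝ) * Complex.I)‖
      ≤ r * ((∫ w : ℝ, ‖(𝓕⁻ χ) w‖) * |lam| ^ (-(1 / 2) : ℝ)) := by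
  have h := Measure.integral_comp_div (fun u : ℝ => χ u * Complex.exp
    ((Real.pi * (lam * u ^ 2) + 2 * Real.pi * ((r * y) * u) : ℝ) * Complex.I)) r
  have e : ∀ v : ℝ, χ (v / r) *
      Complex.exp ((lam * (Real.pi * (v / r) ^ 2) + 2 * Real.pi * (v * y) : ℝ) * Complex.I) =
      χ (v / r) * Complex.exp ((Real.pi * (lam * (v / r) ^ 2) +
        2 * Real.pi * ((r * y) * (v / r)) : ℝ) * Complex.I) := by
    intro v
    congr 4
    field_simp
  simp_rw [e]
  rw [h, norm_smul, Real.norm_eq_abs, abs_abs, abs_of_pos hr]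
  gcongr
  exact norm_integral_mul_cexp_sq_le χ hlam (r * y)

/-- A linear phase only translates the Fourier transform. There is no uniform decay at fixed r; it
appears after integration over r. -/
theorem norm_integral_dilate_mul_cexp_linear (χ : 𝓢(ℝ, ℂ)) (lam y : ℝ) {r : ℝ} (hr : 0 < r) :
    ‖∫ v : ℝ, χ (v / r) *
        Complex.exp ((lam * (2 * Real.pi * (v / r)) + 2 * Real.pi * (v * y) : ℝ) * Complex.I)‖
      = r * ‖(𝓕 χ) (-(lam + r * y))‖ := by
  have h := Measure.integral_comp_div (fun u : ℝ => χ u * Complex.exp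
    ((2 * Real.pi * (lam + r * y) * u : ℝ) * Complex.I)) r
  have e : ∀ v : ℝ, χ (v / r) *
      Complex.exp ((lam * (2 * Real.pi * (v / r)) + 2 * Real.pi * (v * y) : ℝ) * Complex.I) =
      χ (v / r) * Complex.exp ((2 * Real.pi * (lam + r * y) * (v / r) : ℝ) * Complex.I) := by
    intro v
    congr 4
    field_simp
  simp_rw [e]
  rw [h, norm_smul, Real.norm_eq_abs, abs_abs, abs_of_pos hr, SchwartzMap.fourier_coe,
    Real.fourier_real_eq_integral_exp_smul]
  congr 3
  ext u
  rw [smul_eq_mul, mul_comm]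
  congr 3
  push_cast
  ring

/-! ### The phase and the amplitude. -/

/-- A smooth function on the line that agrees with `t⁻¹` for `N⁻¹ ≤ t`. -/
noncomputable def smoothInv (N t : ℝ) : ℝ := Real.smoothTransition (2 * N * t - 1) / t

theorem smoothInv_of_le {N t : ℝ} (hN : 0 < N) (ht : N⁻¹ ≤ t) : smoothInv N t = t⁻¹ := by
  have : 1 ≤ 2 * N * t - 1 := by
    have := mul_le_mul_of_nonneg_left ht hN.le
    rw [mul_inv_cancel₀ hN.ne'] at this
    linarith
  rw [smoothInv, Real.smoothTransition.one_of_one_le this, one_div]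

theorem contDiff_smoothInv (N : ℝ) : ContDiff ℝ ∞ (smoothInv N) := by
  rw [contDiff_iff_contDiffAt]
  intro t
  rcases eq_or_ne t 0 with rfl | ht
  -- The cutoff vanishes near 0, so the singular quotient is locally zero, including its default
  -- value at 0.
  · have h0 : smoothInv N =ᶠ[nhds 0] fun _ => 0 := by
      have hc : Continuous fun t : ℝ => 2 * N * t - 1 := by fun_prop
      have := (hc.tendsto 0).eventually (gt_mem_nhds (show 2 * N * 0 - 1 < (0 : ℝ) by simp))
      filter_upwards [this] with t ht
      rw [smoothInv, Real.smoothTransition.zero_of_nonpos ht.le, zero_div]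
    exact contDiffAt_const.congr_of_eventuallyEq h0
  · refine ContDiffAt.div ?_ contDiffAt_id ht
    exact Real.smoothTransition.contDiffAt.comp t (by fun_prop)

/-- The phase in one affine coordinate: linear in the first one, quadratic in the others. -/
noncomputable def affinePhase {n : ℕ} (j : Fin (n + 1)) (u : ℝ) : ℝ :=
  if j = 0 then 2 * Real.pi * u else Real.pi * u ^ 2

theorem contDiff_affinePhase {n : ℕ} (j : Fin (n + 1)) : ContDiff ℝ ∞ (affinePhase j) := by
  unfold affinePhase
  split_ifs <;> fun_prop

/-- A smooth function that equals the sum of the phases of the affine coordinates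
`ξ (j + 1) / ξ 0` where `ξ 0` is not too small. -/
noncomputable def conePhase (n : ℕ) (ξ : EuclideanSpace ℝ (Fin (n + 2))) : ℝ :=
  ∑ j : Fin (n + 1), affinePhase j (ξ j.succ * smoothInv (n + 2) (ξ 0))

theorem contDiff_lateral {n : ℕ} (j : Fin (n + 1)) :
    ContDiff ℝ ∞ fun ξ : EuclideanSpace ℝ (Fin (n + 2)) =>
      ξ j.succ * smoothInv (n + 2) (ξ 0) := by
  have := contDiff_smoothInv ((n : ℝ) + 2)
  fun_prop

theorem contDiff_conePhase (n : ℕ) : ContDiff ℝ ∞ (conePhase n) :=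
  ContDiff.sum fun j _ => (contDiff_affinePhase j).comp (contDiff_lateral j)

/-- The restriction of `conePhase` to the unit sphere. -/
noncomputable def spherePhase (n : ℕ) (z : sphere (0 : EuclideanSpace ℝ (Fin (n + 2))) 1) : ℝ :=
  conePhase n z

theorem smoothOnSphere_spherePhase {n : ℕ} (hd : 2 ≤ n + 2) :
    SmoothOnSphere hd (spherePhase n) := by
  have : Fact (Module.finrank ℝ (EuclideanSpace ℝ (Fin (n + 2))) = (n + 2 - 1) + 1) :=
    ⟨by rw [finrank_euclideanSpace_fin]; omega⟩
  exact (contDiff_conePhase n).contMDiff.comp contMDiff_coe_sphere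

/-- A bump function supported in `1 < t < 2`. -/
noncomputable def radialBump : ContDiffBump (3 / 2 : ℝ) := ⟨1 / 4, 1 / 2, by norm_num, by norm_num⟩

/-- A bump function supported in `|u| < 1`. -/
noncomputable def lateralBump : ContDiffBump (0 : ℝ) := ⟨1 / 2, 1, by norm_num, by norm_num⟩

theorem mem_Ioo_of_radialBump_ne_zero {t : ℝ} (h : radialBump t ≠ 0) : t ∈ Set.Ioo (1 : ℝ) 2 := by
  have h' : t ∈ Function.support radialBump := h
  rw [radialBump.support_eq, Real.ball_eq_Ioo] at h'
  simp only [radialBump] at h'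
  constructor <;> linarith [h'.1, h'.2]

theorem abs_lt_of_lateralBump_ne_zero {t : ℝ} (h : lateralBump t ≠ 0) : |t| < 1 := by
  have h' : t ∈ Function.support lateralBump := h
  rw [lateralBump.support_eq, mem_ball_zero_iff] at h'
  rwa [← Real.norm_eq_abs]

/-- The amplitude: a product of bump functions in the radial variable and in the affine
coordinates. -/
noncomputable def coneAmplitude (n : ℕ) (ξ : EuclideanSpace ℝ (Fin (n + 2))) : ℝ :=
  radialBump (ξ 0) * ∏ j : Fin (n + 1), lateralBump (ξ j.succ * smoothInv (n + 2) (ξ 0))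

theorem contDiff_coneAmplitude (n : ℕ) : ContDiff ℝ ∞ (coneAmplitude n) := by
  refine ContDiff.mul (radialBump.contDiff.comp (by fun_prop)) ?_
  exact contDiff_prod fun j _ => lateralBump.contDiff.comp (contDiff_lateral j)

theorem inv_add_two_le_of_one_le {n : ℕ} {t : ℝ} (ht : 1 ≤ t) : ((n : ℝ) + 2)⁻¹ ≤ t :=
  (inv_le_one_of_one_le₀ (by have := n.cast_nonneg (α := ℝ); linarith)).trans ht

/-- The bound ξ₀/‖ξ‖ ≥ 1/(n+2) is what fixes the threshold in `smoothInv (n + 2)`: it is exact both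
at ξ and at ξ/‖ξ‖. -/
theorem of_coneAmplitude_ne_zero {n : ℕ} {ξ : EuclideanSpace ℝ (Fin (n + 2))}
    (h : coneAmplitude n ξ ≠ 0) :
    ξ 0 ∈ Set.Ioo (1 : ℝ) 2 ∧ ‖ξ‖ ≤ (n + 2) * ξ 0 := by
  have h0 := mem_Ioo_of_radialBump_ne_zero (left_ne_zero_of_mul h)
  have hpos : 0 < ξ 0 := by linarith [h0.1]
  have hn : (0 : ℝ) < n + 2 := by positivity
  have hs : smoothInv (n + 2) (ξ 0) = (ξ 0)⁻¹ :=
    smoothInv_of_le hn (inv_add_two_le_of_one_le h0.1.le)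
  have hj : ∀ i, |ξ i| ≤ ξ 0 := by
    intro i
    refine Fin.cases ?_ (fun j => ?_) i
    · rw [abs_of_pos hpos]
    · have := abs_lt_of_lateralBump_ne_zero
        (Finset.prod_ne_zero_iff.1 (right_ne_zero_of_mul h) j (Finset.mem_univ j))
      rw [hs, ← div_eq_mul_inv, abs_div, abs_of_pos hpos, div_lt_one hpos] at this
      exact this.le
  refine ⟨h0, ?_⟩
  refine le_of_sq_le_sq ?_ (by positivity)
  rw [EuclideanSpace.norm_sq_eq]
  calc ∑ i, ‖ξ i‖ ^ 2 ≤ ∑ _i : Fin (n + 2), ξ 0 ^ 2 := by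
        gcongr with i
        exact hj i
    _ = (n + 2) * ξ 0 ^ 2 := by simp
    _ ≤ ((n + 2) * ξ 0) ^ 2 := by
        rw [mul_pow]
        gcongr
        nlinarith [n.cast_nonneg (α := ℝ)]

/-! ### Wave packets and their group law. -/

/-- The Fourier transform of the wave packet with parameter `lam`. -/
noncomputable def packetSymbol (n : ℕ) (lam : ℝ) (ξ : EuclideanSpace ℝ (Fin (n + 2))) : ℂ :=
  coneAmplitude n ξ * Complex.exp ((lam * conePhase n ξ : ℝ) * Complex.I)

theorem contDiff_packetSymbol (n : ℕ) (lam : ℝ) : ContDiff ℝ ∞ (packetSymbol n lam) := by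
  have h1 : ContDiff ℝ ∞ fun ξ => (coneAmplitude n ξ : ℂ) :=
    Complex.ofRealCLM.contDiff.comp (contDiff_coneAmplitude n)
  have h2 : ContDiff ℝ ∞ fun ξ => ((lam * conePhase n ξ : ℝ) : ℂ) :=
    Complex.ofRealCLM.contDiff.comp (contDiff_const.mul (contDiff_conePhase n))
  exact h1.mul (h2.mul contDiff_const).cexp

theorem norm_packetSymbol (n : ℕ) (lam : ℝ) (ξ : EuclideanSpace ℝ (Fin (n + 2))) :
    ‖packetSymbol n lam ξ‖ = |coneAmplitude n ξ| := by
  rw [packetSymbol, norm_mul, Complex.norm_exp_ofReal_mul_I, mul_one, Complex.norm_real,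
    Real.norm_eq_abs]

theorem hasCompactSupport_packetSymbol (n : ℕ) (lam : ℝ) :
    HasCompactSupport (packetSymbol n lam) := by
  refine HasCompactSupport.of_support_subset_isCompact (isCompact_closedBall 0 ((n + 2) * 2))
    fun ξ hξ => ?_
  have h : coneAmplitude n ξ ≠ 0 := by
    intro h
    exact hξ (by simp [packetSymbol, h])
  obtain ⟨h0, h1⟩ := of_coneAmplitude_ne_zero h
  rw [mem_closedBall_zero_iff]
  refine h1.trans ?_
  gcongr
  exact h0.2.le

/-- The wave packet with parameter `lam`. -/
noncomputable def packet (n : ℕ) (lam : ℝ) : 𝓢(EuclideanSpace ℝ (Fin (n + 2)), ℂ) :=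
  𝓕⁻ ((hasCompactSupport_packetSymbol n lam).toSchwartzMap (contDiff_packetSymbol n lam))

theorem fourier_packet (n : ℕ) (lam : ℝ) :
    𝓕 (packet n lam : EuclideanSpace ℝ (Fin (n + 2)) → ℂ) = packetSymbol n lam := by
  rw [← SchwartzMap.fourier_coe, packet, FourierTransform.fourier_fourierInv_eq]
  rfl

theorem coe_packet (n : ℕ) (lam : ℝ) :
    (packet n lam : EuclideanSpace ℝ (Fin (n + 2)) → ℂ) = 𝓕⁻ (packetSymbol n lam) := by
  rw [packet, SchwartzMap.fourierInv_coe]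
  rfl

/-- On the support of the amplitude the phase depends only on the ratios ξⱼ/ξ₀, hence is invariant
under normalization. -/
theorem conePhase_direction {n : ℕ} {ξ : EuclideanSpace ℝ (Fin (n + 2))}
    (h : coneAmplitude n ξ ≠ 0) (hξ : ξ ≠ 0) :
    spherePhase n (direction ξ hξ) = conePhase n ξ := by
  obtain ⟨h0, h1⟩ := of_coneAmplitude_ne_zero h
  have hpos : 0 < ξ 0 := by linarith [h0.1]
  have hn : (0 : ℝ) < n + 2 := by positivity
  have hnorm : 0 < ‖ξ‖ := norm_pos_iff.2 hξ
  have hs : smoothInv (n + 2) (ξ 0) = (ξ 0)⁻¹ :=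
    smoothInv_of_le hn (inv_add_two_le_of_one_le h0.1.le)
  have hs' : smoothInv (n + 2) (‖ξ‖⁻¹ * ξ 0) = (‖ξ‖⁻¹ * ξ 0)⁻¹ := by
    refine smoothInv_of_le hn ?_
    rw [inv_mul_eq_div, le_div_iff₀ hnorm, inv_mul_le_iff₀ hn]
    exact h1
  simp only [spherePhase, conePhase, direction, PiLp.smul_apply, smul_eq_mul]
  rw [hs, hs']
  refine Finset.sum_congr rfl fun j _ => ?_
  congr 1
  field_simp

theorem oscSymbol_mul_packetSymbol (n : ℕ) (lam mu : ℝ) (ξ : EuclideanSpace ℝ (Fin (n + 2))) :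
    oscSymbol (spherePhase n) lam ξ * packetSymbol n mu ξ = packetSymbol n (lam + mu) ξ := by
  by_cases h : coneAmplitude n ξ = 0
  · simp [packetSymbol, h]
  · have hξ : ξ ≠ 0 := by
      rintro rfl
      have := (of_coneAmplitude_ne_zero h).1.1
      simp only [PiLp.zero_apply] at this
      linarith
    rw [oscSymbol, dif_neg hξ, conePhase_direction h hξ, packetSymbol, packetSymbol,
      mul_left_comm, ← Complex.exp_add]
    congr 2
    push_cast
    ring

theorem multiplierOp_packet (n : ℕ) (lam mu : ℝ) :
    multiplierOp (oscSymbol (spherePhase n) lam) (packet n mu) = packet n (lam + mu) := by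
  rw [multiplierOp, fourier_packet, coe_packet]
  congr 1
  ext ξ
  exact oscSymbol_mul_packetSymbol n lam mu ξ

/-! ### Factorization and sup bound of the packets. -/

theorem integral_euclideanSpace_succ {m : ℕ} {F : EuclideanSpace ℝ (Fin (m + 1)) → ℂ}
    (hF : Integrable F) :
    ∫ ξ, F ξ = ∫ r : ℝ, ∫ v : Fin m → ℝ, F (WithLp.toLp 2 (Fin.cons r v : Fin (m + 1) → ℝ)) := by
  have he : MeasurableEmbedding (WithLp.toLp 2 : (Fin (m + 1) → ℝ) → _) :=
    (MeasurableEquiv.toLp 2 (Fin (m + 1) → ℝ)).measurableEmbedding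
  have hp := PiLp.volume_preserving_toLp (Fin (m + 1))
  have hem := (volume_preserving_piFinSuccAbove (fun _ : Fin (m + 1) => ℝ) 0).symm _
  have hemb := (MeasurableEquiv.piFinSuccAbove
    (fun _ : Fin (m + 1) => ℝ) 0).symm.measurableEmbedding
  have h1 : Integrable fun w : Fin (m + 1) → ℝ => F (WithLp.toLp 2 w) :=
    (hp.integrable_comp_emb he).2 hF
  have h2 := (hem.integrable_comp_emb hemb).2 h1
  rw [← hp.integral_comp he, ← hem.integral_comp hemb, Measure.volume_eq_prod]
  refine (integral_prod _ h2).trans ?_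
  simp [MeasurableEquiv.piFinSuccAbove_symm_apply, Fin.insertNthEquiv]

/-- The lateral bump function as a Schwartz function. -/
noncomputable def lateralSchwartz : 𝓢(ℝ, ℂ) :=
  (lateralBump.hasCompactSupport.comp_left (g := ((↑) : ℝ → ℂ)) (by simp)).toSchwartzMap
    (Complex.ofRealCLM.contDiff.comp lateralBump.contDiff)

theorem lateralSchwartz_apply (u : ℝ) : lateralSchwartz u = lateralBump u := rfl

/-- The one-dimensional oscillatory integral in the `j`-th lateral variable. -/
noncomputable def lateralIntegral {n : ℕ} (j : Fin (n + 1)) (lam r y : ℝ) : ℂ :=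
  ∫ v : ℝ, lateralSchwartz (v / r) *
    Complex.exp ((lam * affinePhase j (v / r) + 2 * Real.pi * (v * y) : ℝ) * Complex.I)

theorem packetSymbol_cons {n : ℕ} (lam : ℝ) {r : ℝ} (hr : radialBump r ≠ 0)
    (v : Fin (n + 1) → ℝ) (x : EuclideanSpace ℝ (Fin (n + 2))) :
    Complex.exp ((2 * Real.pi * inner ℝ (WithLp.toLp 2 (Fin.cons r v : Fin (n + 2) → ℝ)) x : ℝ)
        * Complex.I) • packetSymbol n lam (WithLp.toLp 2 (Fin.cons r v : Fin (n + 2) → ℝ)) =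
      (radialBump r * Complex.exp ((2 * Real.pi * (r * x 0) : ℝ) * Complex.I)) *
        ∏ j : Fin (n + 1), (lateralSchwartz (v j / r) * Complex.exp
          ((lam * affinePhase j (v j / r) + 2 * Real.pi * (v j * x j.succ) : ℝ) * Complex.I)) := by
  have hs : smoothInv (n + 2) r = r⁻¹ := smoothInv_of_le (by positivity)
    (inv_add_two_le_of_one_le (mem_Ioo_of_radialBump_ne_zero hr).1.le)
  have hin : inner ℝ (WithLp.toLp 2 (Fin.cons r v : Fin (n + 2) → ℝ)) x =
      r * x 0 + ∑ j : Fin (n + 1), v j * x j.succ := by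
    rw [PiLp.inner_apply, Fin.sum_univ_succ]
    simp [mul_comm]
  rw [hin, packetSymbol, coneAmplitude, conePhase]
  simp only [Fin.cons_zero, Fin.cons_succ, hs, ← div_eq_mul_inv, smul_eq_mul]
  rw [Finset.prod_mul_distrib, ← Complex.exp_sum]
  simp only [lateralSchwartz_apply]
  push_cast
  rw [mul_left_comm, ← Complex.exp_add, mul_mul_mul_comm, ← Complex.exp_add]
  congr 2
  rw [← Finset.sum_mul, Finset.sum_add_distrib, ← Finset.mul_sum, ← Finset.mul_sum]
  ring

/-- For fixed r = ξ₀ both amplitude and phase separate in the lateral variables, so only the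
integral over r couples them. -/
theorem packet_apply_eq (n : ℕ) (lam : ℝ) (x : EuclideanSpace ℝ (Fin (n + 2))) :
    packet n lam x = ∫ r : ℝ, (radialBump r * Complex.exp ((2 * Real.pi * (r * x 0) : ℝ) *
      Complex.I)) * ∏ j : Fin (n + 1), lateralIntegral j lam r (x j.succ) := by
  have hc : Continuous (packetSymbol n lam) := (contDiff_packetSymbol n lam).continuous
  rw [coe_packet, Real.fourierInv_eq', integral_euclideanSpace_succ]
  · congr 1
    ext r
    by_cases hr : radialBump r = 0
    · simp [packetSymbol, coneAmplitude, hr]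
    · simp_rw [packetSymbol_cons lam hr]
      rw [integral_const_mul]
      congr 1
      exact integral_fintype_prod_volume_eq_prod (fun (j : Fin (n + 1)) (t : ℝ) =>
        lateralSchwartz (t / r) * Complex.exp
          ((lam * affinePhase j (t / r) + 2 * Real.pi * (t * x j.succ) : ℝ) * Complex.I))
  · refine Continuous.integrable_of_hasCompactSupport (by fun_prop) ?_
    refine HasCompactSupport.intro (hasCompactSupport_packetSymbol n lam) fun ξ hξ => ?_
    rw [image_eq_zero_of_notMem_tsupport hξ, smul_zero]

theorem exists_norm_packet_le (n : ℕ) :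
    ∃ K : ℝ, 0 < K ∧ ∀ lam : ℝ, lam ≠ 0 → ∀ x,
      ‖packet n lam x‖ ≤ K * |lam| ^ (-(((n + 2 : ℕ) : ℝ) / 2)) := by
  obtain ⟨C, hC0, hC⟩ := exists_setIntegral_norm_comp_affine_le (𝓕 lateralSchwartz)
  set D : ℝ := ∫ w : ℝ, ‖(𝓕⁻ lateralSchwartz) w‖ with hD
  have hD0 : 0 ≤ D := integral_nonneg fun _ => norm_nonneg _
  -- Each factor 2 bounds r, the Jacobian of v = ru; the 1 keeps the constant positive.
  refine ⟨2 * C * (2 * D) ^ n + 1, by positivity, fun lam hlam x => ?_⟩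
  have hlam' : 0 < |lam| := abs_pos.2 hlam
  set q : ℝ := 2 * (D * |lam| ^ (-(1 / 2) : ℝ)) with hq
  have hq0 : 0 ≤ q := by positivity
  set M : ℝ → ℝ := fun r => 2 * q ^ n * ‖(𝓕 lateralSchwartz) (-(lam + r * x 1))‖ with hM
  have hMc : Continuous M := by
    have := (𝓕 lateralSchwartz).continuous
    fun_prop
  have hpt : ∀ r : ℝ, ‖(radialBump r * Complex.exp ((2 * Real.pi * (r * x 0) : ℝ) *
      Complex.I)) * ∏ j : Fin (n + 1), lateralIntegral j lam r (x j.succ)‖ ≤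
      (Set.Icc (1 : ℝ) 2).indicator M r := by
    intro r
    by_cases hr : radialBump r = 0
    · simp only [hr, Complex.ofReal_zero, zero_mul, norm_zero]
      exact Set.indicator_nonneg (fun r _ => by positivity) r
    · have hr' := mem_Ioo_of_radialBump_ne_zero hr
      have hr0 : 0 < r := by linarith [hr'.1]
      rw [Set.indicator_of_mem (Set.Ioo_subset_Icc_self hr'), norm_mul, norm_mul,
        Complex.norm_exp_ofReal_mul_I, mul_one, Complex.norm_real, Real.norm_eq_abs,
        abs_of_nonneg radialBump.nonneg, norm_prod, Fin.prod_univ_succ]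
      have h0 : ‖lateralIntegral (0 : Fin (n + 1)) lam r (x (Fin.succ 0))‖ ≤
          2 * ‖(𝓕 lateralSchwartz) (-(lam + r * x 1))‖ := by
        simp only [lateralIntegral, affinePhase, if_true]
        rw [norm_integral_dilate_mul_cexp_linear _ _ _ hr0]
        gcongr
        · exact hr'.2.le
        · rfl
      have hj : ∀ j : Fin n, ‖lateralIntegral j.succ lam r (x j.succ.succ)‖ ≤ q := by
        intro j
        simp only [lateralIntegral, affinePhase, Fin.succ_ne_zero, if_false]
        refine (norm_integral_dilate_mul_cexp_sq_le _ hlam _ hr0).trans ?_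
        rw [hq]
        gcongr
        exact hr'.2.le
      have hprod : ∏ j : Fin n, ‖lateralIntegral j.succ lam r (x j.succ.succ)‖ ≤ q ^ n := by
        calc _ ≤ ∏ _j : Fin n, q := Finset.prod_le_prod (fun _ _ => norm_nonneg _) fun j _ => hj j
          _ = q ^ n := by simp
      calc _ ≤ 1 * (2 * ‖(𝓕 lateralSchwartz) (-(lam + r * x 1))‖ * q ^ n) := by
            gcongr
            exact radialBump.le_one
        _ = M r := by rw [hM]; ring
  -- The exponents add up to 1 + n/2 = (n + 2)/2.
  have hexp : |lam|⁻¹ * (|lam| ^ (-(1 / 2) : ℝ)) ^ n = |lam| ^ (-(((n + 2 : ℕ) : ℝ) / 2)) := by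
    rw [← Real.rpow_natCast, ← Real.rpow_mul hlam'.le, ← Real.rpow_neg_one,
      ← Real.rpow_add hlam']
    congr 1
    push_cast
    ring
  rw [packet_apply_eq]
  calc _ ≤ ∫ r, (Set.Icc (1 : ℝ) 2).indicator M r :=
        norm_integral_le_of_norm_le (hMc.integrableOn_Icc.integrable_indicator measurableSet_Icc)
          (Filter.Eventually.of_forall hpt)
    _ = 2 * q ^ n * ∫ r in Set.Icc (1 : ℝ) 2, ‖(𝓕 lateralSchwartz) (-(lam + r * x 1))‖ := by
        rw [integral_indicator measurableSet_Icc, hM, integral_const_mul]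
    _ ≤ 2 * q ^ n * (C * |lam|⁻¹) := by
        gcongr
        exact hC lam hlam _
    _ = 2 * C * (2 * D) ^ n * (|lam|⁻¹ * (|lam| ^ (-(1 / 2) : ℝ)) ^ n) := by
        rw [hq]; ring
    _ ≤ _ := by
        rw [hexp]
        gcongr
        linarith

/-! ### Comparison of L_p norms with constants uniform in p. -/

theorem min_one_le_rpow {w s : ℝ} (hw : 0 < w) (hs0 : 0 ≤ s) (hs1 : s ≤ 1) : min w 1 ≤ w ^ s := by
  rcases le_total w 1 with h | h
  · rw [min_eq_left h]
    simpa using Real.rpow_le_rpow_of_exponent_ge hw h hs1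
  · rw [min_eq_right h]
    exact Real.one_le_rpow h hs0

theorem rpow_le_max_one {w s : ℝ} (hw : 0 < w) (hs0 : 0 ≤ s) (hs1 : s ≤ 1) : w ^ s ≤ max w 1 := by
  rcases le_total w 1 with h | h
  · rw [max_eq_right h]
    exact Real.rpow_le_one hw.le h hs0
  · rw [max_eq_left h]
    simpa using Real.rpow_le_rpow_of_exponent_le h hs1

section Schwartz

variable {E : Type*} [NormedAddCommGroup E] [NormedSpace ℝ E] [FiniteDimensional ℝ E]
  [MeasurableSpace E] [BorelSpace E] {μ : Measure E} [μ.IsAddHaarMeasure]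

theorem SchwartzMap.integrable_norm_rpow (f : 𝓢(E, ℂ)) {p : ℝ} (hp : 0 < p) :
    Integrable (fun x => ‖f x‖ ^ p) μ := by
  have := (f.memLp (ENNReal.ofReal p) μ).integrable_norm_rpow (by simpa using hp)
    ENNReal.ofReal_ne_top
  rwa [ENNReal.toReal_ofReal hp.le] at this

theorem SchwartzMap.eLpNorm_ofReal_eq (f : 𝓢(E, ℂ)) {p : ℝ} (hp : 0 < p) :
    eLpNorm f (ENNReal.ofReal p) μ = ENNReal.ofReal ((∫ x, ‖f x‖ ^ p ∂μ) ^ p⁻¹) := by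
  have := (f.memLp (ENNReal.ofReal p) μ).eLpNorm_eq_integral_rpow_norm (by simpa using hp)
    ENNReal.ofReal_ne_top
  rwa [ENNReal.toReal_ofReal hp.le] at this

theorem SchwartzMap.integral_norm_rpow_le_of_norm_le (f : 𝓢(E, ℂ)) {p q M : ℝ} (hp : 0 < p)
    (hpq : p ≤ q) (hM : ∀ x, ‖f x‖ ≤ M) :
    ∫ x, ‖f x‖ ^ q ∂μ ≤ M ^ (q - p) * ∫ x, ‖f x‖ ^ p ∂μ := by
  rw [← integral_const_mul]
  refine integral_mono (f.integrable_norm_rpow (hp.trans_le hpq))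
    ((f.integrable_norm_rpow hp).const_mul _) fun x => ?_
  have h : ‖f x‖ ^ q = ‖f x‖ ^ (q - p) * ‖f x‖ ^ p := by
    rw [← Real.rpow_add_of_nonneg (norm_nonneg _) (by linarith) hp.le, sub_add_cancel]
  dsimp only
  rw [h]
  gcongr
  exact hM x

theorem SchwartzMap.integral_norm_rpow_le_add (f : 𝓢(E, ℂ)) {p : ℝ} (hp1 : 1 ≤ p) (hp2 : p ≤ 2) :
    ∫ x, ‖f x‖ ^ p ∂μ ≤ ∫ x, ‖f x‖ ∂μ + ∫ x, ‖f x‖ ^ (2 : ℝ) ∂μ := by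
  rw [← integral_add f.integrable.norm (f.integrable_norm_rpow two_pos)]
  refine integral_mono (f.integrable_norm_rpow (by linarith))
    (f.integrable.norm.add (f.integrable_norm_rpow two_pos)) fun x => ?_
  dsimp only [Pi.add_apply]
  have h0 := norm_nonneg (f x)
  rcases le_total ‖f x‖ 1 with h | h
  · have : ‖f x‖ ^ p ≤ ‖f x‖ := by
      rcases h0.eq_or_lt with h0 | h0
      · rw [← h0, Real.zero_rpow (by linarith)]
      · simpa using Real.rpow_le_rpow_of_exponent_ge h0 h hp1
    have := Real.rpow_nonneg h0 2
    linarith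
  · have := Real.rpow_le_rpow_of_exponent_le h hp2
    linarith

/-- Where |f| ≥ η one has |f|^p ≥ η^(p-2)|f|², and the part with |f| < η carries at most η‖f‖₁ of
the L₂ mass. The resulting bound has a p-th root bounded below uniformly in p. -/
theorem SchwartzMap.exists_le_integral_norm_rpow (f : 𝓢(E, ℂ))
    (hf : 0 < ∫ x, ‖f x‖ ^ (2 : ℝ) ∂μ) :
    ∃ l : ℝ, 0 < l ∧ ∀ p : ℝ, 2 ≤ p → l ≤ (∫ x, ‖f x‖ ^ p ∂μ) ^ p⁻¹ := by
  set A := ∫ x, ‖f x‖ ^ (2 : ℝ) ∂μ with hA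
  set B := ∫ x, ‖f x‖ ∂μ with hB
  have hB0 : 0 ≤ B := integral_nonneg fun _ => norm_nonneg _
  -- Chosen so that η‖f‖₁ ≤ A/2; the cap at 1 yields η^((p-2)/p) ≥ η.
  set η : ℝ := min (A / (2 * (B + 1))) 1 with hη
  have hη0 : 0 < η := lt_min (by positivity) one_pos
  have hηB : η * B ≤ A / 2 := by
    have h1 : η * (B + 1) ≤ A / 2 := by
      calc η * (B + 1) ≤ A / (2 * (B + 1)) * (B + 1) := by gcongr; exact min_le_left _ _
        _ = A / 2 := by field_simp
    linarith
  refine ⟨η * min (A / 2) 1, mul_pos hη0 (lt_min (by positivity) one_pos), fun p hp => ?_⟩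
  have hp0 : 0 < p := by linarith
  have hpinv : p⁻¹ ≤ 1 := inv_le_one_of_one_le₀ (by linarith)
  have hpt : ∀ x, η ^ (p - 2) * (‖f x‖ ^ (2 : ℝ) - η * ‖f x‖) ≤ ‖f x‖ ^ p := by
    intro x
    have h0 := norm_nonneg (f x)
    rcases le_total ‖f x‖ η with h | h
    · have h1 : ‖f x‖ ^ (2 : ℝ) - η * ‖f x‖ ≤ 0 := by
        rw [Real.rpow_two]; nlinarith
      exact (mul_nonpos_of_nonneg_of_nonpos (by positivity) h1).trans (by positivity)
    · have h1 : ‖f x‖ ^ p = ‖f x‖ ^ (p - 2) * ‖f x‖ ^ (2 : ℝ) := by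
        rw [← Real.rpow_add_of_nonneg h0 (by linarith) two_pos.le, sub_add_cancel]
      rw [h1]
      have h2 : ‖f x‖ ^ (2 : ℝ) - η * ‖f x‖ ≤ ‖f x‖ ^ (2 : ℝ) := by
        have := mul_nonneg hη0.le h0
        linarith
      calc _ ≤ η ^ (p - 2) * ‖f x‖ ^ (2 : ℝ) := by gcongr
        _ ≤ _ := by gcongr
  have hint : Integrable (fun x => ‖f x‖ ^ (2 : ℝ) - η * ‖f x‖) μ :=
    (f.integrable_norm_rpow two_pos).sub (f.integrable.norm.const_mul _)
  have h1 : η ^ (p - 2) * (A / 2) ≤ ∫ x, ‖f x‖ ^ p ∂μ := by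
    calc η ^ (p - 2) * (A / 2) ≤ η ^ (p - 2) * (A - η * B) := by gcongr; linarith
      _ = ∫ x, η ^ (p - 2) * (‖f x‖ ^ (2 : ℝ) - η * ‖f x‖) ∂μ := by
        rw [integral_const_mul, integral_sub (f.integrable_norm_rpow two_pos)
          (f.integrable.norm.const_mul _), integral_const_mul]
      _ ≤ _ := integral_mono (hint.const_mul _) (f.integrable_norm_rpow hp0) hpt
  calc η * min (A / 2) 1 ≤ η ^ ((p - 2) * p⁻¹) * (A / 2) ^ p⁻¹ := by
        gcongr
        · have : (p - 2) * p⁻¹ ≤ 1 := by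
            rw [← div_eq_mul_inv, div_le_one hp0]; linarith
          simpa using Real.rpow_le_rpow_of_exponent_ge hη0 (min_le_right _ _) this
        · exact min_one_le_rpow (by positivity) (by positivity) hpinv
    _ = (η ^ (p - 2) * (A / 2)) ^ p⁻¹ := by
        rw [Real.mul_rpow (by positivity) (by positivity), ← Real.rpow_mul hη0.le]
    _ ≤ _ := by gcongr

end Schwartz

theorem ofReal_le_of_ofReal_le_mul {c : ℝ≥0∞} {k X X' Y Y' : ℝ} (hY : 0 < Y')
    (h : ENNReal.ofReal X ≤ c * ENNReal.ofReal Y) (hX : X' ≤ X) (hYY : Y ≤ Y')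
    (hk : k * Y' ≤ X') : ENNReal.ofReal k ≤ c := by
  induction c with
  | top => exact le_top
  | coe c =>
    have h1 : ENNReal.ofReal X ≤ ENNReal.ofReal (c * Y') := by
      rw [ENNReal.ofReal_mul c.coe_nonneg, ENNReal.ofReal_coe_nnreal]
      refine h.trans ?_
      gcongr
    have h2 : X ≤ c * Y' := (ENNReal.ofReal_le_ofReal_iff (by positivity)).1 h1
    rw [ENNReal.ofReal_le_coe]
    exact le_of_mul_le_mul_right (hk.trans (hX.trans h2)) hY

/-! ### The L₂ norm of the packets and the lower bound. -/

theorem continuous_coneAmplitude (n : ℕ) : Continuous (coneAmplitude n) :=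
  (contDiff_coneAmplitude n).continuous

theorem integral_norm_packet_sq (n : ℕ) (lam : ℝ) :
    ∫ x, ‖packet n lam x‖ ^ (2 : ℝ) = ∫ ξ, coneAmplitude n ξ ^ 2 := by
  have h := SchwartzMap.integral_norm_sq_fourier (packet n lam)
  simp only [Real.rpow_two]
  rw [← h, SchwartzMap.fourier_coe, fourier_packet]
  simp only [norm_packetSymbol, sq_abs]

theorem integral_coneAmplitude_sq_pos (n : ℕ) : 0 < ∫ ξ, coneAmplitude n ξ ^ 2 := by
  have hs : HasCompactSupport fun ξ => coneAmplitude n ξ ^ 2 := by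
    refine HasCompactSupport.intro (hasCompactSupport_packetSymbol n 0) fun ξ hξ => ?_
    have := image_eq_zero_of_notMem_tsupport hξ
    rw [← norm_eq_zero, norm_packetSymbol, abs_eq_zero] at this
    rw [this, zero_pow two_ne_zero]
  have hc := (continuous_coneAmplitude n).pow 2
  refine hc.integral_pos_of_hasCompactSupport_nonneg_nonzero hs (fun ξ => sq_nonneg _)
    (x := EuclideanSpace.single 0 (3 / 2)) ?_
  have h1 : radialBump (3 / 2 : ℝ) = 1 :=
    radialBump.one_of_mem_closedBall (mem_closedBall_self radialBump.rIn_pos.le)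
  have h2 : lateralBump (0 : ℝ) = 1 :=
    lateralBump.one_of_mem_closedBall (mem_closedBall_self lateralBump.rIn_pos.le)
  simp [coneAmplitude, h1, h2, Fin.succ_ne_zero]

theorem proposition1 (d : ℕ) (hd : 2 ≤ d) :
    ∃ φ : sphere (0 : EuclideanSpace ℝ (Fin d)) 1 → ℝ, SmoothOnSphere hd φ ∧
      ∃ C : ℝ, 0 < C ∧ ∃ L : ℝ, 0 < L ∧
        ∀ p : ℝ, 1 < p → ∀ lam : ℝ, L ≤ |lam| →
          ENNReal.ofReal (C * |lam| ^ ((d : ℝ) * |1 / 2 - 1 / p|)) ≤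
            multiplierNorm (oscSymbol φ lam) (ENNReal.ofReal p) := by
  obtain ⟨n, rfl⟩ : ∃ n, d = n + 2 := ⟨d - 2, by omega⟩
  refine ⟨spherePhase n, smoothOnSphere_spherePhase hd, ?_⟩
  obtain ⟨K₀, hK₀, hK₀'⟩ := exists_norm_packet_le n
  -- K ≥ 1 makes powers of K monotone in the exponent, so the p-dependence can be removed.
  obtain ⟨K, hK1, hK⟩ : ∃ K : ℝ, 1 ≤ K ∧ ∀ lam : ℝ, lam ≠ 0 → ∀ x,
      ‖packet n lam x‖ ≤ K * |lam| ^ (-(((n + 2 : ℕ) : ℝ) / 2)) := by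
    refine ⟨max K₀ 1, le_max_right _ _, fun lam hlam x => (hK₀' lam hlam x).trans ?_⟩
    gcongr
    exact le_max_left _ _
  have hKpos : 0 < K := by linarith
  set A : ℝ := ∫ ξ, coneAmplitude n ξ ^ 2 with hA
  have hA0 : 0 < A := integral_coneAmplitude_sq_pos n
  have hL2 : ∀ lam, ∫ x, ‖packet n lam x‖ ^ (2 : ℝ) = A := integral_norm_packet_sq n
  obtain ⟨l, hl0, hl⟩ := (packet n 0).exists_le_integral_norm_rpow (μ := volume)
    (by rw [hL2]; exact hA0)
  set B : ℝ := max ((∫ x, ‖packet n 0 x‖) + A) 1 with hB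
  have hB0 : 0 < B := lt_max_of_lt_right one_pos
  have ha0 : 0 < min A 1 := lt_min hA0 one_pos
  refine ⟨min (min A 1 * K⁻¹ / B) (l / (max A 1 * K)), lt_min (by positivity) (by positivity),
    1, one_pos, fun p hp lam hlam => le_sInf fun c hc => ?_⟩
  have hlam0 : 0 < |lam| := by linarith
  have hlam' : lam ≠ 0 := abs_pos.1 hlam0
  have hp0 : 0 < p := by linarith
  have hpinv : p⁻¹ ≤ 1 := inv_le_one_of_one_le₀ hp.le
  set t : ℝ := |lam| ^ (-(((n + 2 : ℕ) : ℝ) / 2)) with ht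
  have ht0 : 0 < t := by positivity
  set R : ℝ := |lam| ^ (((n + 2 : ℕ) : ℝ) * |1 / 2 - 1 / p|) with hR
  have hR0 : 0 < R := by positivity
  rcases le_total p 2 with hp2 | hp2
  -- For p ≤ 2 the input f_0 is fixed and the output f_λ is large: A ≤ ‖f_λ‖_∞^(2-p) ‖f_λ‖_p^p.
  · have h := hc (packet n 0)
    rw [multiplierOp_packet, add_zero, SchwartzMap.eLpNorm_ofReal_eq _ hp0,
      SchwartzMap.eLpNorm_ofReal_eq _ hp0] at h
    refine ofReal_le_of_ofReal_le_mul (X' := min A 1 * K⁻¹ * R) hB0 h ?_ ?_ ?_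
    · have h1 := (packet n lam).integral_norm_rpow_le_of_norm_le (μ := volume) hp0 hp2 (hK lam hlam')
      rw [hL2, mul_comm, ← div_le_iff₀ (by positivity), div_eq_mul_inv,
        ← Real.rpow_neg (by positivity), neg_sub] at h1
      have hRt : R = t ^ ((p - 2) * p⁻¹) := by
        rw [hR, ht, ← Real.rpow_mul hlam0.le,
          abs_of_nonpos (sub_nonpos.2 (one_div_le_one_div_of_le hp0 hp2))]
        congr 1
        field_simp
      calc min A 1 * K⁻¹ * R ≤ A ^ p⁻¹ * K ^ ((p - 2) * p⁻¹) * R := by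
            gcongr
            · exact min_one_le_rpow hA0 (by positivity) hpinv
            · rw [← Real.rpow_neg_one]
              refine Real.rpow_le_rpow_of_exponent_le hK1 ?_
              rw [← div_eq_mul_inv, le_div_iff₀ hp0]
              linarith
        _ = (A * (K * t) ^ (p - 2)) ^ p⁻¹ := by
            rw [Real.mul_rpow (by positivity) (by positivity), ← Real.rpow_mul (by positivity),
              Real.mul_rpow (by positivity) (by positivity), hRt, mul_assoc]
        _ ≤ _ := by gcongr
    · have h1 := (packet n 0).integral_norm_rpow_le_add (μ := volume) hp.le hp2
      rw [hL2] at h1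
      have h2 : ∫ x, ‖packet n 0 x‖ ^ p ≤ B := h1.trans (le_max_left _ _)
      calc (∫ x, ‖packet n 0 x‖ ^ p) ^ p⁻¹ ≤ B ^ p⁻¹ := by gcongr
        _ ≤ max B 1 := rpow_le_max_one hB0 (by positivity) hpinv
        _ = B := max_eq_left (le_max_right _ _)
    · calc _ ≤ min A 1 * K⁻¹ / B * R * B := by gcongr; exact min_le_left _ _
        _ = _ := by field_simp
  -- For p ≥ 2 the input f_{-λ} is small and the output f_0 is fixed.
  · have h := hc (packet n (-lam))
    rw [multiplierOp_packet, add_neg_cancel, SchwartzMap.eLpNorm_ofReal_eq _ hp0,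
      SchwartzMap.eLpNorm_ofReal_eq _ hp0] at h
    refine ofReal_le_of_ofReal_le_mul (Y' := max A 1 * K * R⁻¹) (by positivity) h (hl p hp2) ?_ ?_
    · have h1 := (packet n (-lam)).integral_norm_rpow_le_of_norm_le (μ := volume) two_pos hp2
        (hK (-lam) (neg_ne_zero.2 hlam'))
      rw [hL2, abs_neg, ← ht] at h1
      have hRt : R⁻¹ = t ^ ((p - 2) * p⁻¹) := by
        rw [hR, ht, ← Real.rpow_mul hlam0.le, ← Real.rpow_neg hlam0.le,
          abs_of_nonneg (sub_nonneg.2 (one_div_le_one_div_of_le two_pos hp2))]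
        congr 1
        field_simp
      calc (∫ x, ‖packet n (-lam) x‖ ^ p) ^ p⁻¹ ≤ ((K * t) ^ (p - 2) * A) ^ p⁻¹ := by gcongr
        _ = A ^ p⁻¹ * K ^ ((p - 2) * p⁻¹) * R⁻¹ := by
            rw [Real.mul_rpow (by positivity) (by positivity), ← Real.rpow_mul (by positivity),
              Real.mul_rpow (by positivity) (by positivity), hRt]
            ring
        _ ≤ max A 1 * K * R⁻¹ := by
            gcongr
            · exact rpow_le_max_one hA0 (by positivity) hpinv
            · have : (p - 2) * p⁻¹ ≤ 1 := by
                rw [← div_eq_mul_inv, div_le_one hp0]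
                linarith
              simpa using Real.rpow_le_rpow_of_exponent_le hK1 this
    · calc _ ≤ l / (max A 1 * K) * R * (max A 1 * K * R⁻¹) := by gcongr; exact min_le_right _ _
        _ = l := by field_simp
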